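/- For an integer $d\ge 1$ let $\mathcal{Q}(\mathbb{C}^d)$ be the set of states, i.e. positive semidefinite complex $d\times d$ matrices $\rho$ with $\operatorname{Tr}\rho=1$, and let $\mathcal{E}(\mathbb{C}^d)$ be the set of effects, i.e. matrices $E$ with $0\preceq E\preceq I$. Identify $\rho\in\mathcal{Q}(\mathbb{C}^d)$ with the function $f_\rho(E)=\operatorname{Tr}(E\rho)$ on $\mathcal{E}(\mathbb{C}^d)$, so that $\mathcal{Q}(\mathbb{C}^d)$ is regarded as a class of real functions on $\mathcal{E}(\mathbb{C}^d)$. For $n\ge1$ and a sample $x_1,\dots,x_n\in\mathcal{E}(\mathbb{C}^d)$ with empirical measure $\mu_n=\frac1n\sum_{i=1}^n\delta_{x_i}$, put $\|f\|_{L_2(\mu_n)}=\bigl(\frac1n\sum_{i=1}^n|f(x_i)|^2\bigr)^{1/2}$. For $\varepsilon>0$ and a class $\mathcal{F}$ of real functions on $\mathcal{E}(\mathbb{C}^d)$, let $\mathcal{N}(\varepsilon,\mathcal{F},L_2(\mu_n))$ be the minimum cardinality of a set $G$ of real functions on $\mathcal{E}(\mathbb{C}^d)$ (not necessarily in $\mathcal{F}$)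 such that every $f\in\mathcal{F}$ has some $g\in G$ with $\|f-g\|_{L_2(\mu_n)}<\varepsilon$. Let $\mathcal{N}_2(\varepsilon,\mathcal{F},n)=\sup_{\mu_n}\mathcal{N}(\varepsilon,\mathcal{F},L_2(\mu_n))$, the supremum being over all samples of size $n$. Then there is an absolute constant $C>0$ such that for all integers $d\ge1$ and $n\ge1$ and all real $\varepsilon>0$, $$\log\mathcal{N}_2\bigl(\varepsilon,\mathcal{Q}(\mathbb{C}^d),n\bigr)\le \frac{C\log d}{\varepsilon^2}.$$ In particular, $\mathcal{N}_2(\varepsilon,\mathcal{Q}(\mathbb{C}^d),n)$ is finite. -/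

import Mathlib

open scoped ENNReal ComplexOrder

noncomputable section

namespace QuantumLearning

/-- The state space of `ℂ^d`: density matrices. -/
def stateSpace (d : ℕ) : Set (Matrix (Fin d) (Fin d) ℂ) :=
  {ρ | ρ.PosSemidef ∧ ρ.trace = 1}

/-- The effect space of `ℂ^d`: matrices `E` with `0 ≤ E ≤ 1` in the Loewner order. -/
def effectSpace (d : ℕ) : Set (Matrix (Fin d) (Fin d) ℂ) :=
  {E | E.PosSemidef ∧ (1 - E).PosSemidef}

/-- The functional `f_ρ : E ↦ Tr(E ρ)` on the effect space. The trace is a real number for every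
state `ρ` (see `ofReal_stateFunctional`), so taking its real part loses nothing. -/
def stateFunctional {d : ℕ} (ρ : stateSpace d) (E : effectSpace d) : ℝ :=
  ((E : Matrix (Fin d) (Fin d) ℂ) * (ρ : Matrix (Fin d) (Fin d) ℂ)).trace.re

theorem ofReal_stateFunctional {d : ℕ} (ρ : stateSpace d) (E : effectSpace d) :
    (stateFunctional ρ E : ℂ) =
      ((E : Matrix (Fin d) (Fin d) ℂ) * (ρ : Matrix (Fin d) (Fin d) ℂ)).trace := by
  unfold stateFunctional
  rw [← Complex.conj_eq_iff_re]
  have h := Matrix.trace_conjTranspose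
    ((E : Matrix (Fin d) (Fin d) ℂ) * (ρ : Matrix (Fin d) (Fin d) ℂ))
  rw [Matrix.conjTranspose_mul, E.2.1.isHermitian.eq, ρ.2.1.isHermitian.eq,
    Matrix.trace_mul_comm] at h
  exact h.symm

/-- The function class `𝒬(ℂ^d) = {f_ρ : ρ a state}` of functions on the input space `ℰ(ℂ^d)`. -/
def stateClass (d : ℕ) : Set (effectSpace d → ℝ) :=
  Set.range stateFunctional

/-- `C` is an `ε`-cover of `F` with respect to the distance function `dist`. The centers in `C`
need not lie in `F`. -/
def IsCover {Y : Type*} (dist : Y → Y → ℝ) (ε : ℝ) (F C : Set Y) : Prop :=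
  ∀ f ∈ F, ∃ y ∈ C, dist f y < ε

/-- The covering number `𝒩(ε, F, dist)`: the minimum cardinality of an `ε`-cover of `F`
(equal to `⊤` if there is no finite one). -/
def coveringNumber {Y : Type*} (dist : Y → Y → ℝ) (ε : ℝ) (F : Set Y) : ℕ∞ :=
  ⨅ (C : Set Y) (_ : IsCover dist ε F C), C.encard

/-- The norm `‖f‖_{L₂(μ_n)}`, where `μ_n` is the empirical measure of the sample `x`. -/
def empiricalL2Norm {X : Type*} {n : ℕ} (x : Fin n → X) (f : X → ℝ) : ℝ :=
  Real.sqrt ((n : ℝ)⁻¹ * ∑ i, |f (x i)| ^ 2)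

/-- The distance between two functions in `L₂(μ_n)`. -/
def empiricalL2Dist {X : Type*} {n : ℕ} (x : Fin n → X) (f g : X → ℝ) : ℝ :=
  empiricalL2Norm x (f - g)

/-- `𝒩₂(ε, F, n)`: the supremum of `𝒩(ε, F, L₂(μ_n))` over all samples of size `n`. -/
def empiricalCoveringNumber {X : Type*} (ε : ℝ) (F : Set (X → ℝ)) (n : ℕ) : ℕ∞ :=
  ⨆ x : Fin n → X, coveringNumber (empiricalL2Dist x) ε F

/-- The entropy number `log 𝒩₂(ε, F, n)` as an extended real; it is `⊤` when the covering
number is infinite. -/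
def entropyNumber {X : Type*} (ε : ℝ) (F : Set (X → ℝ)) (n : ℕ) : EReal :=
  ENNReal.log ((empiricalCoveringNumber ε F n : ℕ∞) : ℝ≥0∞)

end QuantumLearning

end

/-! Scaled by `a = n^(-1/2)`, the values of the states on the sample form a set `V` in `Fin n → ℝ`
of Euclidean diameter at most 1, and the empirical distance is the Euclidean one. Pairing a Gaussian
vector `g` with the point of `ρ` gives `Tr (X ρ)`, where `X = ∑ i, g i • (a • x i)`. The supremum
over states is controlled by the largest eigenvalue of `X` in absolute value, hence by `Tr X^(2p)`.

Trace and expectation commute, so `E Tr X^(2p) ≤ d * ‖E X^(2p)‖`. Mixed Gaussian moments are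
nonnegative and effects have norm at most 1, so this norm is at most the `2p`-th moment of a scalar
standard Gaussian (`norm_integral_sum_pow_le`, `integral_sum_pow_le`). With `p` about `log d` the
factor `d` costs only `e^p`, and Markov's inequality bounds the process by `K = √(110 p)` with
probability at least 1/2.

Sudakov's argument then bounds covers of `V`: translates of the polar body along separated points
are disjoint, yet each keeps a definite share of Gaussian mass (`card_le_of_separated_of_absPolar`).
Applied locally, scale by scale, it gives entropy of order `K^2 / ε^2`, that is `log d / ε^2`. -/

open MeasureTheory ProbabilityTheory

noncomputable section

namespace QuantumLearning

/-! ### Standard Gaussian vectors: translation and moments -/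

section GaussianVector

variable {ι : Type*} [Fintype ι]

/-- The density of the standard Gaussian measure on `ι → ℝ`. -/
def stdGaussianDensity (x : ι → ℝ) : ℝ := ∏ i, gaussianPDFReal 0 1 (x i)

/-- The standard Gaussian measure on `ι → ℝ`. -/
def stdGaussianPi (ι : Type*) [Fintype ι] : Measure (ι → ℝ) :=
  volume.withDensity fun x => ENNReal.ofReal (stdGaussianDensity x)

theorem stdGaussianDensity_nonneg (x : ι → ℝ) : 0 ≤ stdGaussianDensity x :=
  Finset.prod_nonneg fun _ _ => gaussianPDFReal_nonneg _ _ _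

theorem measurable_stdGaussianDensity : Measurable (stdGaussianDensity (ι := ι)) := by
  unfold stdGaussianDensity
  exact Finset.measurable_prod _ fun i _ =>
    (measurable_gaussianPDFReal 0 1).comp (measurable_pi_apply i)

theorem stdGaussianDensity_neg (x : ι → ℝ) : stdGaussianDensity (-x) = stdGaussianDensity x := by
  simp [stdGaussianDensity, gaussianPDFReal]

theorem stdGaussianDensity_add (x v : ι → ℝ) :
    stdGaussianDensity (x + v) =
      stdGaussianDensity x * Real.exp (-(∑ i, x i * v i) - (∑ i, v i ^ 2) / 2) := by
  have : -(∑ i, x i * v i) - (∑ i, v i ^ 2) / 2 = ∑ i, (-(x i * v i) - v i ^ 2 / 2) := by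
    rw [Finset.sum_sub_distrib, Finset.sum_neg_distrib, Finset.sum_div]
  rw [this, Real.exp_sum]
  unfold stdGaussianDensity
  rw [← Finset.prod_mul_distrib]
  refine Finset.prod_congr rfl fun i _ => ?_
  simp only [gaussianPDFReal, Pi.add_apply, mul_assoc, ← Real.exp_add]
  congr 2
  simp only [NNReal.coe_one]
  ring

/-- Averaging over `v` and `-v` turns the linear term of the exponent into a hyperbolic cosine,
which is at least 1. -/
theorem stdGaussianDensity_add_add_sub (x v : ι → ℝ) :
    2 * (Real.exp (-(∑ i, v i ^ 2) / 2) * stdGaussianDensity x) ≤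
      stdGaussianDensity (x + v) + stdGaussianDensity (x + -v) := by
  rw [stdGaussianDensity_add, stdGaussianDensity_add]
  simp only [Pi.neg_apply, mul_neg, neg_sq, Finset.sum_neg_distrib, neg_neg]
  set t := ∑ i, x i * v i
  have h1 : Real.exp (-t - (∑ i, v i ^ 2) / 2) =
      Real.exp (-(∑ i, v i ^ 2) / 2) * Real.exp (-t) := by rw [← Real.exp_add]; ring_nf
  have h2 : Real.exp (t - (∑ i, v i ^ 2) / 2) =
      Real.exp (-(∑ i, v i ^ 2) / 2) * Real.exp t := by rw [← Real.exp_add]; ring_nf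
  rw [h1, h2]
  have h3 : 2 ≤ Real.exp (-t) + Real.exp t := by
    linarith [Real.add_one_le_exp t, Real.add_one_le_exp (-t)]
  have h4 : 0 ≤ Real.exp (-(∑ i, v i ^ 2) / 2) * stdGaussianDensity x :=
    mul_nonneg (Real.exp_pos _).le (stdGaussianDensity_nonneg x)
  nlinarith [mul_le_mul_of_nonneg_left h3 h4]

/-- A symmetric set loses at most a factor `exp (-|v|² / 2)` of its Gaussian measure when it is
translated by `v`. -/
theorem stdGaussianPi_translate {A : Set (ι → ℝ)} (hA : MeasurableSet A)
    (hsymm : ∀ x ∈ A, -x ∈ A) (v : ι → ℝ) :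
    ENNReal.ofReal (Real.exp (-(∑ i, v i ^ 2) / 2)) * stdGaussianPi ι A ≤
      stdGaussianPi ι {x | x - v ∈ A} := by
  have hmd : Measurable fun x : ι → ℝ => ENNReal.ofReal (stdGaussianDensity x) :=
    measurable_stdGaussianDensity.ennreal_ofReal
  have key : ∀ u : ι → ℝ, stdGaussianPi ι {x | x - u ∈ A} =
      ∫⁻ x in A, ENNReal.ofReal (stdGaussianDensity (x + u)) := by
    intro u
    have hm : MeasurableSet {x | x - u ∈ A} := (measurable_id.sub_const u) hA
    rw [stdGaussianPi, withDensity_apply _ hm, ← lintegral_indicator hm, ← lintegral_indicator hA,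
      ← lintegral_add_right_eq_self _ u]
    refine lintegral_congr fun x => ?_
    by_cases hx : x ∈ A <;> simp [Set.indicator, hx]
  -- Reflection preserves both `A` and the density, so the two translates have equal mass and the
  -- averaged density bound applies.
  have hneg : ∫⁻ x in A, ENNReal.ofReal (stdGaussianDensity (x + -v)) =
      ∫⁻ x in A, ENNReal.ofReal (stdGaussianDensity (x + v)) := by
    rw [← lintegral_indicator hA, ← lintegral_indicator hA, ← lintegral_neg_eq_self]
    refine lintegral_congr fun x => ?_
    have hx : -x ∈ A ↔ x ∈ A := ⟨fun h => by simpa using hsymm _ h, hsymm x⟩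
    have hd : stdGaussianDensity (-x + -v) = stdGaussianDensity (x + v) := by
      rw [← neg_add, stdGaussianDensity_neg]
    by_cases h : x ∈ A <;> simp [Set.indicator, hx, h, hd]
  have h2 : 2 * (ENNReal.ofReal (Real.exp (-(∑ i, v i ^ 2) / 2)) * stdGaussianPi ι A) ≤
      2 * stdGaussianPi ι {x | x - v ∈ A} := by
    rw [two_mul (stdGaussianPi ι {x | x - v ∈ A}), key v]
    nth_rewrite 2 [← hneg]
    have hadd : (∫⁻ x in A, ENNReal.ofReal (stdGaussianDensity (x + v))) +
        ∫⁻ x in A, ENNReal.ofReal (stdGaussianDensity (x + -v)) =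
        ∫⁻ x in A, (ENNReal.ofReal (stdGaussianDensity (x + v)) +
          ENNReal.ofReal (stdGaussianDensity (x + -v))) :=
      (lintegral_add_left (hmd.comp (measurable_id.add_const v)) _).symm
    rw [hadd, stdGaussianPi,
      withDensity_apply _ hA, ← lintegral_const_mul _ hmd, ← lintegral_const_mul _
      (hmd.const_mul _)]
    refine lintegral_mono fun x => ?_
    rw [← ENNReal.ofReal_mul (Real.exp_pos _).le,
      ← ENNReal.ofReal_add (stdGaussianDensity_nonneg _) (stdGaussianDensity_nonneg _)]
    have := ENNReal.ofReal_le_ofReal (stdGaussianDensity_add_add_sub x v)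
    rwa [ENNReal.ofReal_mul (by norm_num), ENNReal.ofReal_ofNat] at this
  exact (ENNReal.mul_le_mul_iff_right (by norm_num) (by norm_num)).1 h2

theorem integral_stdGaussianPi_prod (f : ι → ℝ → ℝ) :
    ∫ x, ∏ i, f i (x i) ∂stdGaussianPi ι = ∏ i, ∫ t, f i t ∂gaussianReal 0 1 := by
  rw [stdGaussianPi, integral_withDensity_eq_integral_toReal_smul
    measurable_stdGaussianDensity.ennreal_ofReal (Filter.Eventually.of_forall fun _ => by simp)]
  simp_rw [ENNReal.toReal_ofReal (stdGaussianDensity_nonneg _), stdGaussianDensity, smul_eq_mul,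
    ← Finset.prod_mul_distrib, integral_gaussianReal_eq_integral_smul one_ne_zero, smul_eq_mul]
  exact integral_fintype_prod_volume_eq_prod fun i t => gaussianPDFReal 0 1 t * f i t

theorem integrable_gaussianReal_iff (f : ℝ → ℝ) :
    Integrable f (gaussianReal 0 1) ↔ Integrable fun t => gaussianPDFReal 0 1 t * f t := by
  rw [gaussianReal_of_var_ne_zero _ one_ne_zero,
    integrable_withDensity_iff_integrable_smul' (measurable_gaussianPDF 0 1)
      (Filter.Eventually.of_forall fun _ => gaussianPDF_lt_top)]
  simp [toReal_gaussianPDF]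

theorem integrable_stdGaussianPi_prod {f : ι → ℝ → ℝ}
    (hf : ∀ i, Integrable (f i) (gaussianReal 0 1)) :
    Integrable (fun x : ι → ℝ => ∏ i, f i (x i)) (stdGaussianPi ι) := by
  rw [stdGaussianPi, integrable_withDensity_iff_integrable_smul'
    measurable_stdGaussianDensity.ennreal_ofReal (Filter.Eventually.of_forall fun _ => by simp)]
  simp_rw [ENNReal.toReal_ofReal (stdGaussianDensity_nonneg _), stdGaussianDensity, smul_eq_mul,
    ← Finset.prod_mul_distrib]
  exact Integrable.fintype_prod (f := fun i t => gaussianPDFReal 0 1 t * f i t)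
    fun i => (integrable_gaussianReal_iff _).1 (hf i)

instance isProbabilityMeasure_stdGaussianPi : IsProbabilityMeasure (stdGaussianPi ι) := by
  have h := integral_stdGaussianPi_prod (ι := ι) fun _ _ => 1
  simp only [Finset.prod_const_one, integral_const, smul_eq_mul, mul_one,
    Measure.real, measure_univ, ENNReal.toReal_one] at h
  exact ⟨(ENNReal.toReal_eq_one_iff _).1 h⟩

theorem integrable_pow_gaussianReal (k : ℕ) : Integrable (fun t : ℝ => t ^ k) (gaussianReal 0 1) := by
  have h := (memLp_id_gaussianReal (μ := 0) (v := 1) (k : NNReal)).integrable_norm_pow'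
  refine (integrable_norm_iff (by fun_prop)).1 ?_
  simpa [norm_pow] using h

theorem integral_pow_gaussianReal_nonneg (k : ℕ) : 0 ≤ ∫ t, t ^ k ∂gaussianReal 0 1 := by
  rcases Nat.even_or_odd k with hk | hk
  · exact integral_nonneg fun t => hk.pow_nonneg t
  · have h : ∫ t, t ^ k ∂gaussianReal 0 1 = ∫ t, (-t) ^ k ∂gaussianReal 0 1 := by
      conv_lhs => rw [← neg_zero, ← gaussianReal_map_neg]
      exact integral_map (by fun_prop) (by fun_prop)
    simp_rw [hk.neg_pow, integral_neg] at h
    linarith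

theorem integrable_monomial_stdGaussianPi (w : ι → ℕ) :
    Integrable (fun x : ι → ℝ => ∏ i, x i ^ w i) (stdGaussianPi ι) :=
  integrable_stdGaussianPi_prod fun i => integrable_pow_gaussianReal (w i)

theorem integral_monomial_stdGaussianPi_nonneg (w : ι → ℕ) :
    0 ≤ ∫ x : ι → ℝ, ∏ i, x i ^ w i ∂stdGaussianPi ι := by
  rw [integral_stdGaussianPi_prod fun i t => t ^ w i]
  exact Finset.prod_nonneg fun i _ => integral_pow_gaussianReal_nonneg (w i)

theorem integrable_exp_stdGaussianPi (c : ℝ) :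
    Integrable (fun x : ι → ℝ => Real.exp (c * ∑ i, x i)) (stdGaussianPi ι) := by
  simp_rw [Finset.mul_sum, Real.exp_sum]
  exact integrable_stdGaussianPi_prod (f := fun _ t => Real.exp (c * t))
    fun _ => integrable_exp_mul_gaussianReal c

theorem integral_exp_stdGaussianPi (c : ℝ) :
    ∫ x : ι → ℝ, Real.exp (c * ∑ i, x i) ∂stdGaussianPi ι =
      Real.exp (Fintype.card ι * (c ^ 2 / 2)) := by
  simp_rw [Finset.mul_sum, Real.exp_sum]
  rw [integral_stdGaussianPi_prod fun _ t => Real.exp (c * t)]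
  have h : ∫ t, Real.exp (c * t) ∂gaussianReal 0 1 = Real.exp (c ^ 2 / 2) := by
    have := congrFun (mgf_fun_id_gaussianReal (μ := 0) (v := 1)) c
    simpa [mgf] using this
  rw [h, Finset.prod_const, Finset.card_univ, ← Real.exp_nat_mul]

/-! ### Moments of Gaussian series in a normed algebra -/

section Moments

variable {𝔸 : Type*} [NormedRing 𝔸] [NormedAlgebra ℝ 𝔸]

/-- Peeling one factor off the power moves its Gaussian variable into the monomial. Carrying an
arbitrary monomial weight thus allows induction on the power without expanding noncommutative
products. -/
theorem monomial_smul_sum_pow_succ [DecidableEq ι] (A : ι → 𝔸) (w : ι → ℕ) (m : ℕ) (x : ι → ℝ) :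
    (∏ i, x i ^ w i) • (∑ i, x i • A i) ^ (m + 1) =
      ∑ j, A j * ((∏ i, x i ^ (w + Pi.single j 1 : ι → ℕ) i) • (∑ i, x i • A i) ^ m) := by
  rw [pow_succ', Finset.sum_mul, Finset.smul_sum]
  refine Finset.sum_congr rfl fun j _ => ?_
  have : ∏ i, x i ^ (w + Pi.single j 1 : ι → ℕ) i = (∏ i, x i ^ w i) * x j := by
    simp_rw [Pi.add_apply, pow_add, Finset.prod_mul_distrib]
    congr 1
    rw [Finset.prod_eq_single j] <;> simp +contextual
  rw [this, mul_smul_comm, smul_mul_assoc, smul_smul]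

theorem integrable_monomial_smul_sum_pow (A : ι → 𝔸) (m : ℕ) (w : ι → ℕ) :
    Integrable (fun x : ι → ℝ => (∏ i, x i ^ w i) • (∑ i, x i • A i) ^ m) (stdGaussianPi ι) := by
  classical
  induction m generalizing w with
  | zero => simpa using (integrable_monomial_stdGaussianPi w).smul_const (1 : 𝔸)
  | succ m ih =>
    simp_rw [monomial_smul_sum_pow_succ]
    exact integrable_finsetSum _ fun j _ => (ih (w + Pi.single j 1 : ι → ℕ)).const_mul (A j)

theorem integral_monomial_smul_sum_pow_succ [DecidableEq ι] (A : ι → 𝔸) (m : ℕ) (w : ι → ℕ) :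
    ∫ x : ι → ℝ, (∏ i, x i ^ w i) • (∑ i, x i • A i) ^ (m + 1) ∂stdGaussianPi ι =
      ∑ j, A j * ∫ x : ι → ℝ,
        (∏ i, x i ^ (w + Pi.single j 1 : ι → ℕ) i) • (∑ i, x i • A i) ^ m ∂stdGaussianPi ι := by
  simp_rw [monomial_smul_sum_pow_succ]
  refine (integral_finsetSum _ fun j _ =>
    (integrable_monomial_smul_sum_pow A m (w + Pi.single j 1)).const_mul (A j)).trans ?_
  exact Finset.sum_congr rfl fun j _ =>
    integral_const_mul_of_integrable (integrable_monomial_smul_sum_pow A m (w + Pi.single j 1))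

/-- The moments of a Gaussian series with coefficients in a normed algebra are dominated by those
of the scalar series formed with the norms of the coefficients, since the mixed moments of the
Gaussian variables are nonnegative. -/
theorem norm_integral_monomial_smul_sum_pow_le [NormOneClass 𝔸] [CompleteSpace 𝔸] (A : ι → 𝔸)
    {a : ι → ℝ} (ha : ∀ i, ‖A i‖ ≤ a i) (m : ℕ) (w : ι → ℕ) :
    ‖∫ x : ι → ℝ, (∏ i, x i ^ w i) • (∑ i, x i • A i) ^ m ∂stdGaussianPi ι‖ ≤
      ∫ x : ι → ℝ, (∏ i, x i ^ w i) • (∑ i, x i • a i) ^ m ∂stdGaussianPi ι := by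
  classical
  induction m generalizing w with
  | zero =>
    simp only [pow_zero, integral_smul_const, norm_smul, norm_one, mul_one, smul_eq_mul,
      Real.norm_eq_abs]
    rw [abs_of_nonneg (integral_monomial_stdGaussianPi_nonneg w)]
  | succ m ih =>
    rw [integral_monomial_smul_sum_pow_succ, integral_monomial_smul_sum_pow_succ]
    refine (norm_sum_le _ _).trans (Finset.sum_le_sum fun j _ => ?_)
    exact (norm_mul_le _ _).trans (mul_le_mul (ha j) (ih _) (norm_nonneg _)
      ((norm_nonneg _).trans (ha j)))

theorem integrable_sum_pow (A : ι → 𝔸) (m : ℕ) :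
    Integrable (fun x : ι → ℝ => (∑ i, x i • A i) ^ m) (stdGaussianPi ι) := by
  simpa using integrable_monomial_smul_sum_pow A m 0

theorem norm_integral_sum_pow_le [NormOneClass 𝔸] [CompleteSpace 𝔸] (A : ι → 𝔸)
    {a : ι → ℝ} (ha : ∀ i, ‖A i‖ ≤ a i) (m : ℕ) :
    ‖∫ x : ι → ℝ, (∑ i, x i • A i) ^ m ∂stdGaussianPi ι‖ ≤
      ∫ x : ι → ℝ, (∑ i, x i * a i) ^ m ∂stdGaussianPi ι := by
  simpa using norm_integral_monomial_smul_sum_pow_le A ha m 0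

end Moments

/-- The sum is a standard Gaussian `s`. With `t = √(2p)`, the exponential series and `(2p)! ≤
(2p)^(2p)` give `s^(2p) ≤ (2p)^p (e^(ts) + e^(-ts))`, and each exponential has mean `e^p`. -/
theorem integral_sum_pow_le {p : ℕ} (hp : 1 ≤ p) {a : ℝ} (ha : Fintype.card ι * a ^ 2 = 1) :
    ∫ x : ι → ℝ, (∑ i, x i * a) ^ (2 * p) ∂stdGaussianPi ι ≤
      2 * (2 * Real.exp 1 * p) ^ p := by
  set t : ℝ := Real.sqrt (2 * p) with ht
  have hp' : (0 : ℝ) < p := by exact_mod_cast hp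
  have ht2 : t ^ 2 = 2 * p := Real.sq_sqrt (by positivity)
  have hkt : t ^ (2 * p) = (2 * p : ℝ) ^ p := by rw [pow_mul, ht2]
  have hpt : ∀ x : ι → ℝ, (∑ i, x i * a) ^ (2 * p) ≤ (2 * p : ℝ) ^ p *
      (Real.exp ((t * a) * ∑ i, x i) + Real.exp (-(t * a) * ∑ i, x i)) := by
    intro x
    rw [← Finset.sum_mul]
    set s := (∑ i, x i) * a with hs
    have e1 : (t * a) * ∑ i, x i = t * s := by rw [hs]; ring
    have e2 : -(t * a) * ∑ i, x i = -(t * s) := by rw [hs]; ring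
    rw [e1, e2]
    have h1 := Real.pow_div_factorial_le_exp |t * s| (abs_nonneg _) (2 * p)
    rw [(even_two_mul p).pow_abs, mul_pow, hkt] at h1
    have h2 : Real.exp |t * s| ≤ Real.exp (t * s) + Real.exp (-(t * s)) := by
      rcases abs_cases (t * s) with ⟨h, _⟩ | ⟨h, _⟩ <;> rw [h]
      · linarith [Real.exp_pos (-(t * s))]
      · linarith [Real.exp_pos (t * s)]
    have h3 : ((2 * p).factorial : ℝ) ≤ (2 * p : ℝ) ^ p * (2 * p : ℝ) ^ p := by
      rw [← pow_add, ← two_mul]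
      exact_mod_cast Nat.factorial_le_pow (2 * p)
    have hf : (0 : ℝ) < (2 * p).factorial := by exact_mod_cast Nat.factorial_pos _
    have hq : (0 : ℝ) < (2 * p : ℝ) ^ p := by positivity
    have h4 : (2 * p : ℝ) ^ p * s ^ (2 * p) ≤
        (2 * p : ℝ) ^ p * ((2 * p : ℝ) ^ p * (Real.exp (t * s) + Real.exp (-(t * s)))) := by
      calc _ ≤ ((2 * p).factorial : ℝ) * (Real.exp (t * s) + Real.exp (-(t * s))) := by
            rw [div_le_iff₀ hf] at h1
            nlinarith
        _ ≤ ((2 * p : ℝ) ^ p * (2 * p : ℝ) ^ p) * _ :=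
            mul_le_mul_of_nonneg_right h3 (by positivity)
        _ = _ := by ring
    exact le_of_mul_le_mul_left h4 hq
  have hi := ((integrable_exp_stdGaussianPi (ι := ι) (t * a)).add
    (integrable_exp_stdGaussianPi (ι := ι) (-(t * a)))).const_mul ((2 * p : ℝ) ^ p)
  refine (integral_mono (integrable_sum_pow (fun _ : ι => a) (2 * p)) hi hpt).trans (le_of_eq ?_)
  simp only [Pi.add_apply]
  rw [integral_const_mul, integral_add (integrable_exp_stdGaussianPi _)
    (integrable_exp_stdGaussianPi _), integral_exp_stdGaussianPi, integral_exp_stdGaussianPi]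
  have e : (Fintype.card ι : ℝ) * ((t * a) ^ 2 / 2) = p * 1 := by
    rw [mul_pow, ht2]; linear_combination (p : ℝ) * ha
  rw [neg_sq, e, Real.exp_nat_mul, mul_assoc 2 (Real.exp 1), mul_pow 2, mul_pow 2, mul_pow]
  ring

end GaussianVector

/-! ### Sudakov minoration by packing translates -/

section Packing

/-- If the finite `r`-separated subsets of `S` have at most `M` elements, then there is one which
is maximal, and no point of `S` is separated from all of its elements. -/
theorem exists_maximal_separated {X : Type*} (r : X → X → Prop) (hsymm : ∀ x y, r x y → r y x)
    (hirr : ∀ x, ¬ r x x) (S : Set X) (M : ℝ)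
    (hM : ∀ T : Finset X, (∀ t ∈ T, t ∈ S) → (∀ t ∈ T, ∀ u ∈ T, t ≠ u → r t u) → (T.card : ℝ) ≤ M) :
    ∃ T : Finset X, (∀ t ∈ T, t ∈ S) ∧ (T.card : ℝ) ≤ M ∧ ∀ x ∈ S, ∃ t ∈ T, ¬ r x t := by
  classical
  let N : Set ℕ := {k | ∃ T : Finset X, (∀ t ∈ T, t ∈ S) ∧
    (∀ t ∈ T, ∀ u ∈ T, t ≠ u → r t u) ∧ T.card = k}
  have hne : N.Nonempty := ⟨0, ∅, by simp⟩
  have hbdd : BddAbove N := by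
    refine ⟨⌊M⌋₊, ?_⟩
    rintro k ⟨T, h1, h2, rfl⟩
    exact Nat.le_floor (hM T h1 h2)
  obtain ⟨T, h1, h2, h3⟩ := Nat.sSup_mem hne hbdd
  refine ⟨T, h1, hM T h1 h2, fun x hx => ?_⟩
  by_contra! hcon
  have hxT : x ∉ T := fun h => hirr x (hcon x h)
  have hmem : T.card + 1 ∈ N := by
    refine ⟨insert x T, ?_, ?_, Finset.card_insert_of_notMem hxT⟩
    · intro t ht
      rcases Finset.mem_insert.1 ht with rfl | ht
      exacts [hx, h1 t ht]
    · intro t ht u hu htu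
      rcases Finset.mem_insert.1 ht with rfl | ht' <;> rcases Finset.mem_insert.1 hu with rfl | hu'
      · exact absurd rfl htu
      · exact hcon u hu'
      · exact hsymm _ _ (hcon _ ht')
      · exact h2 t ht' u hu' htu
  have := le_csSup hbdd hmem
  omega

variable {ι : Type*} [Fintype ι]

/-- The set of vectors whose scalar products with the elements of `V` are at most `K` in absolute
value. -/
def absPolar (V : Set (ι → ℝ)) (K : ℝ) : Set (ι → ℝ) :=
  {x | ∀ v ∈ V, |∑ i, x i * v i| ≤ K}

theorem measurableSet_absPolar (V : Set (ι → ℝ)) (K : ℝ) : MeasurableSet (absPolar V K) := by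
  have : absPolar V K = ⋂ v ∈ V, {x | |∑ i, x i * v i| ≤ K} := by ext; simp [absPolar]
  rw [this]
  exact (isClosed_biInter fun v _ => isClosed_le (by fun_prop) continuous_const).measurableSet

theorem neg_mem_absPolar {V : Set (ι → ℝ)} {K : ℝ} {x : ι → ℝ} (hx : x ∈ absPolar V K) :
    -x ∈ absPolar V K := fun v hv => by
  simpa [neg_mul, Finset.sum_neg_distrib, abs_neg] using hx v hv

/-- The two points of the polar body differ by `s • (t - u)`. Pairing this difference with `t - u`
leaves four terms, each at most `K`. -/
theorem sum_sq_sub_le_of_translates_meet {V : Set (ι → ℝ)} {K s : ℝ} {c t u x : ι → ℝ}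
    (ht : t ∈ V) (hu : u ∈ V) (hxt : x - s • (t - c) ∈ absPolar V K)
    (hxu : x - s • (u - c) ∈ absPolar V K) : s * ∑ i, (t i - u i) ^ 2 ≤ 4 * K := by
  have key : s * ∑ i, (t i - u i) ^ 2 =
      ((∑ i, (x - s • (u - c)) i * t i) - ∑ i, (x - s • (u - c)) i * u i) -
      ((∑ i, (x - s • (t - c)) i * t i) - ∑ i, (x - s • (t - c)) i * u i) := by
    simp only [← Finset.sum_sub_distrib, Finset.mul_sum, Pi.sub_apply, Pi.smul_apply, smul_eq_mul]
    exact Finset.sum_congr rfl fun i _ => by ring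
  rw [key]
  have h1 := abs_le.1 (hxu t ht)
  have h2 := abs_le.1 (hxu u hu)
  have h3 := abs_le.1 (hxt t ht)
  have h4 := abs_le.1 (hxt u hu)
  linarith [h1.1, h1.2, h2.1, h2.2, h3.1, h3.2, h4.1, h4.2]

/-- A volume argument: the translates by `s • (t - c)` are disjoint, since `s * δ = 5 * K` exceeds
the `4 * K` allowed when two meet, and their Gaussian masses sum to at most 1. Centring at `c` makes
the loss depend on the local radius `R` only. -/
theorem card_le_of_separated_of_absPolar {V : Set (ι → ℝ)} {K δ R : ℝ} (hK : 0 < K) (hδ : 0 < δ)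
    (hγ : 1 / 2 ≤ (stdGaussianPi ι).real (absPolar V K)) (c : ι → ℝ) (T : Finset (ι → ℝ))
    (hT : ∀ t ∈ T, t ∈ V ∧ ∑ i, (t i - c i) ^ 2 ≤ R)
    (hsep : ∀ t ∈ T, ∀ u ∈ T, t ≠ u → δ ≤ ∑ i, (t i - u i) ^ 2) :
    (T.card : ℝ) ≤ 2 * Real.exp ((5 * K / δ) ^ 2 * R / 2) := by
  set s := 5 * K / δ with hs
  set γ := stdGaussianPi ι
  set A := absPolar V K
  have hA : MeasurableSet A := measurableSet_absPolar V K
  let B : (ι → ℝ) → Set (ι → ℝ) := fun t => {x | x - s • (t - c) ∈ A}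
  have hB : ∀ t, MeasurableSet (B t) := fun t => (measurable_id.sub_const (s • (t - c))) hA
  have hdisj : (T : Set (ι → ℝ)).PairwiseDisjoint B := by
    intro t ht u hu htu
    refine Set.disjoint_left.2 fun x hxt hxu => ?_
    have h1 := sum_sq_sub_le_of_translates_meet (hT t ht).1 (hT u hu).1 hxt hxu
    have h2 : s * δ ≤ s * ∑ i, (t i - u i) ^ 2 :=
      mul_le_mul_of_nonneg_left (hsep t ht u hu htu) (by positivity)
    have h3 : s * δ = 5 * K := by rw [hs]; field_simp
    linarith
  have hlow : ∀ t ∈ T, Real.exp (-(s ^ 2 * R / 2)) * (1 / 2) ≤ γ.real (B t) := by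
    intro t ht
    have h1 := stdGaussianPi_translate hA (fun x hx => neg_mem_absPolar hx) (s • (t - c))
    have h2 := ENNReal.toReal_mono (measure_ne_top _ _) h1
    rw [ENNReal.toReal_mul, ENNReal.toReal_ofReal (Real.exp_pos _).le] at h2
    refine le_trans (mul_le_mul ?_ hγ (by norm_num) (Real.exp_pos _).le) h2
    rw [Real.exp_le_exp]
    have h3 : ∑ i, (s • (t - c)) i ^ 2 = s ^ 2 * ∑ i, (t i - c i) ^ 2 := by
      simp [Finset.mul_sum, mul_pow]
    rw [h3]
    have := mul_le_mul_of_nonneg_left (hT t ht).2 (sq_nonneg s)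
    linarith
  have hsum : ∑ t ∈ T, γ.real (B t) ≤ 1 := by
    rw [← measureReal_biUnion_finset hdisj fun t _ => hB t]
    exact measureReal_le_one
  have h5 : T.card * (Real.exp (-(s ^ 2 * R / 2)) * (1 / 2)) ≤ 1 := by
    rw [← nsmul_eq_mul]
    exact (Finset.card_nsmul_le_sum _ _ _ hlow).trans hsum
  rw [Real.exp_neg] at h5
  have := Real.exp_pos (s ^ 2 * R / 2)
  field_simp at h5
  linarith

/-- **Sudakov minoration**, in covering form: if a set of diameter at most one is bounded by `K` on
a set of directions of Gaussian measure at least `1 / 2`, then it has a cover at scale `2 / 2 ^ k`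
with at most `exp ((1 + 50 * K ^ 2) * 4 ^ k)` centers, all in the set. -/
theorem exists_cover_of_absPolar {V : Set (ι → ℝ)} {K : ℝ} (hK : 0 < K) (hne : V.Nonempty)
    (hdiam : ∀ v ∈ V, ∀ w ∈ V, ∑ i, (v i - w i) ^ 2 ≤ 1)
    (hγ : 1 / 2 ≤ (stdGaussianPi ι).real (absPolar V K)) (k : ℕ) :
    ∃ G : Finset (ι → ℝ), (∀ g ∈ G, g ∈ V) ∧
      (G.card : ℝ) ≤ Real.exp ((1 + 50 * K ^ 2) * 4 ^ k) ∧
      ∀ v ∈ V, ∃ g ∈ G, ∑ i, (v i - g i) ^ 2 < 4 / 4 ^ k := by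
  classical
  induction k with
  | zero =>
    obtain ⟨v₀, h₀⟩ := hne
    refine ⟨{v₀}, by simpa using h₀, ?_, fun v hv => ⟨v₀, by simp, ?_⟩⟩
    · rw [Finset.card_singleton, Nat.cast_one]
      exact Real.one_le_exp (by positivity)
    · have := hdiam v hv v₀ h₀
      norm_num
      linarith
  | succ k ih =>
    obtain ⟨G, hGV, hGc, hG⟩ := ih
    have h4 : (1 : ℝ) ≤ 4 ^ k := one_le_pow₀ (by norm_num)
    -- Each ball is refined at half its radius. Keeping `R` comparable to `δ` yields an exponent of
    -- order `K^2 / δ`; a single step from diameter 1 would give `K^2 / δ^2`.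
    have step : ∀ c : ι → ℝ, ∃ T : Finset (ι → ℝ),
        (∀ t ∈ T, t ∈ {v | v ∈ V ∧ ∑ i, (v i - c i) ^ 2 ≤ 4 / 4 ^ k}) ∧
        (T.card : ℝ) ≤ 2 * Real.exp ((5 * K / (4 / 4 ^ (k + 1))) ^ 2 * (4 / 4 ^ k) / 2) ∧
        ∀ x ∈ {v | v ∈ V ∧ ∑ i, (v i - c i) ^ 2 ≤ 4 / 4 ^ k},
          ∃ t ∈ T, ¬ (4 / 4 ^ (k + 1) ≤ ∑ i, (x i - t i) ^ 2) := by
      intro c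
      refine exists_maximal_separated (fun x y : ι → ℝ => 4 / 4 ^ (k + 1) ≤ ∑ i, (x i - y i) ^ 2)
        (fun x y h => ?_) (fun x => ?_) _ _ fun T h1 h2 =>
          card_le_of_separated_of_absPolar hK (by positivity) hγ c T h1 h2
      · simpa only [sub_sq_comm] using h
      · simp
    choose T hT1 hT2 hT3 using step
    refine ⟨G.biUnion T, ?_, ?_, ?_⟩
    · intro g hg
      obtain ⟨c, _, hgc⟩ := Finset.mem_biUnion.1 hg
      exact (hT1 c g hgc).1
    · have hexp : (5 * K / (4 / 4 ^ (k + 1))) ^ 2 * (4 / 4 ^ k) / 2 = 50 * K ^ 2 * (4 : ℝ) ^ k := by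
        rw [pow_succ]
        field_simp
        ring
      have hM : ∀ c ∈ G, ((T c).card : ℝ) ≤ Real.exp ((1 + 50 * K ^ 2) * 4 ^ k) := by
        intro c _
        refine (hT2 c).trans ?_
        rw [hexp, add_mul, one_mul, Real.exp_add]
        refine mul_le_mul_of_nonneg_right ?_ (Real.exp_pos _).le
        linarith [Real.add_one_le_exp ((4 : ℝ) ^ k)]
      calc ((G.biUnion T).card : ℝ) ≤ ∑ c ∈ G, ((T c).card : ℝ) := by
            exact_mod_cast Finset.card_biUnion_le
        _ ≤ G.card * Real.exp ((1 + 50 * K ^ 2) * 4 ^ k) := by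
            rw [← nsmul_eq_mul]
            exact Finset.sum_le_card_nsmul _ _ _ hM
        _ ≤ Real.exp ((1 + 50 * K ^ 2) * 4 ^ k) * Real.exp ((1 + 50 * K ^ 2) * 4 ^ k) :=
            mul_le_mul_of_nonneg_right hGc (Real.exp_pos _).le
        -- Doubling the exponent fits, since the scale factor grows by 4.
        _ ≤ _ := by
            rw [← Real.exp_add, Real.exp_le_exp, pow_succ 4]
            have : 0 ≤ (1 + 50 * K ^ 2) * (4 : ℝ) ^ k := by positivity
            linarith
    · intro v hv
      obtain ⟨c, hc, hvc⟩ := hG v hv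
      obtain ⟨t, ht, hvt⟩ := hT3 c v ⟨hv, hvc.le⟩
      exact ⟨t, Finset.mem_biUnion.2 ⟨c, hc, ht⟩, not_le.1 hvt⟩

end Packing

/-! ### Trace moments of random matrices -/

section Matrices

open Matrix

/-- In an eigenbasis of `X` the trace against `ρ` is an average of eigenvalues, weighted by the
diagonal of the rotated state. Each eigenvalue's even power is at most the trace of that power. -/
theorem abs_re_trace_mul_le {d : ℕ} {X ρ : Matrix (Fin d) (Fin d) ℂ} (hX : X.IsHermitian)
    (hρ : ρ ∈ stateSpace d) {p : ℕ} (hp : 1 ≤ p) {K : ℝ} (hK : 0 ≤ K)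
    (h : (X ^ (2 * p)).trace.re ≤ K ^ (2 * p)) : |(X * ρ).trace.re| ≤ K := by
  set U := hX.eigenvectorUnitary
  set Λ : Matrix (Fin d) (Fin d) ℂ := diagonal (RCLike.ofReal ∘ hX.eigenvalues)
  have hXU : X = Unitary.conjStarAlgAut ℂ _ U Λ := hX.spectral_theorem
  have hUU : star (U : Matrix (Fin d) (Fin d) ℂ) * U = 1 := Unitary.coe_star_mul_self U
  have hUU' : (U : Matrix (Fin d) (Fin d) ℂ) * star (U : Matrix (Fin d) (Fin d) ℂ) = 1 :=
    Unitary.coe_mul_star_self U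
  have htr : (X ^ (2 * p)).trace.re = ∑ i, hX.eigenvalues i ^ (2 * p) := by
    have h1 : X ^ (2 * p) = Unitary.conjStarAlgAut ℂ _ U (Λ ^ (2 * p)) := by
      rw [map_pow, ← hXU]
    rw [h1, Unitary.conjStarAlgAut_apply, trace_mul_cycle, hUU, one_mul,
      diagonal_pow, trace_diagonal, Complex.re_sum]
    refine Finset.sum_congr rfl fun i _ => ?_
    simp [← Complex.ofReal_pow]
  have hev : ∀ i, |hX.eigenvalues i| ≤ K := by
    intro i
    refine le_of_pow_le_pow_left₀ (n := 2 * p) (by omega) hK ?_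
    rw [(even_two_mul p).pow_abs]
    refine le_trans ?_ (htr ▸ h)
    exact Finset.single_le_sum (f := fun i => hX.eigenvalues i ^ (2 * p))
      (fun j _ => (even_two_mul p).pow_nonneg _) (Finset.mem_univ i)
  set σ : Matrix (Fin d) (Fin d) ℂ := star (U : Matrix (Fin d) (Fin d) ℂ) * ρ * U with hσ
  have hσpos : σ.PosSemidef := hρ.1.conjTranspose_mul_mul_same _
  have hσtr : σ.trace = 1 := by rw [hσ, trace_mul_cycle, hUU', one_mul, hρ.2]
  have hdiag : ∀ i, 0 ≤ (σ i i).re := fun i => (Complex.nonneg_iff.1 (hσpos.diag_nonneg (i := i))).1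
  have hmul : (X * ρ).trace.re = ∑ i, hX.eigenvalues i * (σ i i).re := by
    have : (X * ρ).trace = (Λ * σ).trace := by
      have h1 : X * ρ = Unitary.conjStarAlgAut ℂ _ U Λ * ρ := by rw [← hXU]
      rw [h1, Unitary.conjStarAlgAut_apply, hσ, Matrix.mul_assoc, Matrix.mul_assoc,
        trace_mul_comm (U : Matrix (Fin d) (Fin d) ℂ)]
      simp only [Matrix.mul_assoc]
    rw [this, trace, Complex.re_sum]
    refine Finset.sum_congr rfl fun i _ => ?_
    simp [Λ, diagonal_mul]
  rw [hmul]
  calc |∑ i, hX.eigenvalues i * (σ i i).re| ≤ ∑ i, |hX.eigenvalues i * (σ i i).re| :=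
        Finset.abs_sum_le_sum_abs _ _
    _ ≤ ∑ i, K * (σ i i).re := Finset.sum_le_sum fun i _ => by
        rw [abs_mul, abs_of_nonneg (hdiag i)]
        exact mul_le_mul_of_nonneg_right (hev i) (hdiag i)
    _ = K := by
        rw [← Finset.mul_sum, ← Complex.re_sum]
        have : ∑ i, σ i i = 1 := hσtr
        rw [this, Complex.one_re, mul_one]

open scoped Matrix.Norms.L2Operator MatrixOrder

theorem norm_entry_le_l2_opNorm {d : ℕ} (M : Matrix (Fin d) (Fin d) ℂ) (i j : Fin d) :
    ‖M i j‖ ≤ ‖M‖ := by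
  have h := l2_opNorm_mulVec M (EuclideanSpace.single j (1 : ℂ))
  rw [PiLp.norm_single, norm_one, mul_one] at h
  refine le_trans ?_ h
  refine le_trans (le_of_eq ?_) (PiLp.norm_apply_le _ i)
  simp

theorem norm_trace_le {d : ℕ} (M : Matrix (Fin d) (Fin d) ℂ) : ‖M.trace‖ ≤ d * ‖M‖ := by
  refine (norm_sum_le _ _).trans ?_
  refine (Finset.sum_le_card_nsmul _ _ ‖M‖ fun i _ => norm_entry_le_l2_opNorm M i i).trans ?_
  simp

theorem norm_effect_le_one {d : ℕ} (E : effectSpace d) : ‖(E : Matrix (Fin d) (Fin d) ℂ)‖ ≤ 1 := by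
  rw [CStarAlgebra.norm_le_one_iff_of_nonneg _ E.2.1.nonneg, ← sub_nonneg]
  exact E.2.2.nonneg

theorem integral_re_trace_sum_pow_le {d n p : ℕ} (hd : 1 ≤ d) (hp : 1 ≤ p) {a : ℝ} (ha : 0 ≤ a)
    (han : n * a ^ 2 = 1) (x : Fin n → effectSpace d) :
    Integrable (fun g : Fin n → ℝ =>
      ((∑ i, g i • (a • (x i : Matrix (Fin d) (Fin d) ℂ))) ^ (2 * p)).trace.re)
        (stdGaussianPi (Fin n)) ∧
    ∫ g : Fin n → ℝ, ((∑ i, g i • (a • (x i : Matrix (Fin d) (Fin d) ℂ))) ^ (2 * p)).trace.re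
        ∂stdGaussianPi (Fin n) ≤ d * (2 * (2 * Real.exp 1 * p) ^ p) := by
  have : NeZero d := ⟨by omega⟩
  have : NormOneClass (Matrix (Fin d) (Fin d) ℂ) := ⟨CStarRing.norm_one⟩
  have hA : ∀ i, ‖a • (x i : Matrix (Fin d) (Fin d) ℂ)‖ ≤ a := fun i => by
    rw [norm_smul, Real.norm_of_nonneg ha]
    exact mul_le_of_le_one_right ha (norm_effect_le_one (x i))
  let φ : Matrix (Fin d) (Fin d) ℂ →L[ℝ] ℝ := LinearMap.toContinuousLinearMap
    (Complex.reLm.comp (Matrix.traceLinearMap (Fin d) ℝ ℂ))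
  have hφ : ∀ M, φ M = M.trace.re := fun M => rfl
  have hint := integrable_sum_pow (fun i => a • (x i : Matrix (Fin d) (Fin d) ℂ)) (2 * p)
  refine ⟨φ.integrable_comp hint, ?_⟩
  have h1 := φ.integral_comp_comm hint
  simp only [hφ] at h1
  rw [h1]
  refine (Complex.re_le_norm _).trans ((norm_trace_le _).trans ?_)
  refine mul_le_mul_of_nonneg_left ?_ (Nat.cast_nonneg d)
  refine (norm_integral_sum_pow_le _ hA (2 * p)).trans (integral_sum_pow_le hp ?_)
  simpa using han

end Matrices

/-! ### Sample vectors of states -/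

open scoped Matrix.Norms.L2Operator MatrixOrder in
theorem stateFunctional_mem_Icc {d : ℕ} (ρ : stateSpace d) (E : effectSpace d) :
    stateFunctional ρ E ∈ Set.Icc (0 : ℝ) 1 := by
  have key : ∀ M : Matrix (Fin d) (Fin d) ℂ, M.PosSemidef →
      0 ≤ (M * (ρ : Matrix (Fin d) (Fin d) ℂ)).trace.re := by
    intro M hM
    obtain ⟨B, hB⟩ := CStarAlgebra.nonneg_iff_eq_star_mul_self.mp hM.nonneg
    rw [Matrix.star_eq_conjTranspose] at hB
    have h : (M * (ρ : Matrix (Fin d) (Fin d) ℂ)).trace =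
        (B * (ρ : Matrix (Fin d) (Fin d) ℂ) * B.conjTranspose).trace := by
      rw [hB, Matrix.trace_mul_cycle, Matrix.trace_mul_cycle]
    rw [h]
    exact (Complex.nonneg_iff.1 (ρ.2.1.mul_mul_conjTranspose_same B).trace_nonneg).1
  refine ⟨key _ E.2.1, ?_⟩
  have h := key _ E.2.2
  rw [Matrix.sub_mul, Matrix.one_mul, Matrix.trace_sub, ρ.2.2, Complex.sub_re, Complex.one_re] at h
  unfold stateFunctional
  linarith

/-- The values of the states on a sample, each multiplied by `a`. -/
def sampleVectors {d n : ℕ} (a : ℝ) (x : Fin n → effectSpace d) : Set (Fin n → ℝ) :=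
  Set.range fun (ρ : stateSpace d) (i : Fin n) => a * stateFunctional ρ (x i)

theorem half_le_stdGaussianPi_absPolar_sampleVectors {d n p : ℕ} (hd : 1 ≤ d) (hp : 1 ≤ p)
    (hdp : (d : ℝ) ≤ Real.exp p) {a : ℝ} (ha : 0 ≤ a) (han : n * a ^ 2 = 1)
    (x : Fin n → effectSpace d) :
    1 / 2 ≤ (stdGaussianPi (Fin n)).real (absPolar (sampleVectors a x) (Real.sqrt (110 * p))) := by
  set K := Real.sqrt (110 * p)
  have hp' : (0 : ℝ) < p := by exact_mod_cast hp
  have hK2 : K ^ (2 * p) = (110 * p : ℝ) ^ p := by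
    rw [pow_mul, Real.sq_sqrt (by positivity)]
  let X : (Fin n → ℝ) → Matrix (Fin d) (Fin d) ℂ := fun g =>
    ∑ i, g i • (a • (x i : Matrix (Fin d) (Fin d) ℂ))
  have hX : ∀ g, (X g).IsHermitian := fun g =>
    isSelfAdjoint_sum _ fun i _ => (IsSelfAdjoint.all (g i)).smul
      ((IsSelfAdjoint.all a).smul (x i).2.1.isHermitian.isSelfAdjoint)
  let f : (Fin n → ℝ) → ℝ := fun g => ((X g) ^ (2 * p)).trace.re
  have hf0 : ∀ g, 0 ≤ f g := fun g => by
    have h1 : X g ^ (2 * p) = (X g ^ p).conjTranspose * X g ^ p := by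
      rw [Matrix.conjTranspose_pow, (hX g).eq, ← pow_add, two_mul]
    have h2 := (Matrix.posSemidef_conjTranspose_mul_self (X g ^ p)).trace_nonneg
    rw [← h1] at h2
    exact (Complex.nonneg_iff.1 h2).1
  obtain ⟨hfi, hfb⟩ := integral_re_trace_sum_pow_le hd hp ha han x
  have hmarkov := mul_meas_ge_le_integral_of_nonneg (μ := stdGaussianPi (Fin n)) (f := f)
    (Filter.Eventually.of_forall hf0) hfi ((110 * p : ℝ) ^ p)
  -- One factor 2 comes from the scalar moment bound, the other from the target probability 1/2.
  -- Absorbing `4 ≤ e^(2p)` and `d ≤ e^p` leaves the base `2 e^4 p`, and `2 e^4 < 110`.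
  have hbound : 4 * (d * (2 * Real.exp 1 * p) ^ p) ≤ (110 * p : ℝ) ^ p := by
    have he : Real.exp 1 < 2.7182818286 := Real.exp_one_lt_d9
    have he0 := Real.exp_pos 1
    have h2 : (2 : ℝ) ≤ Real.exp 1 := by linarith [Real.add_one_le_exp (1 : ℝ)]
    have h4 : (4 : ℝ) ≤ (Real.exp 1 ^ 2) ^ p :=
      le_trans (by nlinarith) (le_self_pow₀ (by nlinarith) (by omega))
    have hdp' : (d : ℝ) ≤ Real.exp 1 ^ p := by rwa [← Real.exp_nat_mul, mul_one]
    calc 4 * (d * (2 * Real.exp 1 * p) ^ p)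
        ≤ (Real.exp 1 ^ 2) ^ p * (Real.exp 1 ^ p * (2 * Real.exp 1 * p) ^ p) := by gcongr
      _ = (2 * Real.exp 1 ^ 4 * p) ^ p := by
          rw [← mul_pow, ← mul_pow]
          ring
      _ ≤ (110 * p : ℝ) ^ p := by
          have h5 : Real.exp 1 ^ 4 ≤ 2.7182818286 ^ 4 := by gcongr
          have h6 : 2 * Real.exp 1 ^ 4 ≤ 110 := by
            refine (mul_le_mul_of_nonneg_left h5 (by norm_num)).trans (by norm_num)
          gcongr
  have hhalf : (stdGaussianPi (Fin n)).real {g | (110 * p : ℝ) ^ p ≤ f g} ≤ 1 / 2 := by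
    have h1 : (0 : ℝ) < (110 * p : ℝ) ^ p := by positivity
    have h2 := hmarkov.trans hfb
    have h3 : (110 * p : ℝ) ^ p * (stdGaussianPi (Fin n)).real {g | (110 * p : ℝ) ^ p ≤ f g} ≤
        (110 * p : ℝ) ^ p * (1 / 2) := by linarith
    exact le_of_mul_le_mul_left h3 h1
  have hsub : (absPolar (sampleVectors a x) K)ᶜ ⊆ {g | (110 * p : ℝ) ^ p ≤ f g} := by
    intro g hg
    by_contra hlt
    refine hg ?_
    rintro _ ⟨ρ, rfl⟩
    have h1 := abs_re_trace_mul_le (hX g) ρ.2 hp (Real.sqrt_nonneg (110 * p))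
      ((not_le.1 hlt).le.trans_eq hK2.symm)
    have h2 : ∑ i, g i * (a * stateFunctional ρ (x i)) =
        (X g * (ρ : Matrix (Fin d) (Fin d) ℂ)).trace.re := by
      simp [X, stateFunctional, Finset.sum_mul, Matrix.trace_sum, Matrix.trace_smul]
    rw [h2]
    exact h1
  have h1 := (measureReal_mono (μ := stdGaussianPi (Fin n)) hsub).trans hhalf
  rw [probReal_compl_eq_one_sub (measurableSet_absPolar _ _)] at h1
  linarith

/-! ### Covers of the state class and entropy numbers -/

theorem entropyNumber_le {X : Type*} {ε L : ℝ} {F : Set (X → ℝ)} {n : ℕ}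
    (h : ∀ x : Fin n → X, ∃ G : Finset (X → ℝ),
      IsCover (empiricalL2Dist x) ε F G ∧ (G.card : ℝ) ≤ Real.exp L) :
    entropyNumber ε F n ≤ (L : EReal) := by
  have h1 : empiricalCoveringNumber ε F n ≤ ((⌊Real.exp L⌋₊ : ℕ) : ℕ∞) := by
    refine iSup_le fun x => ?_
    obtain ⟨G, hG, hc⟩ := h x
    refine (iInf₂_le (G : Set (X → ℝ)) hG).trans ?_
    rw [Set.encard_coe_eq_coe_finsetCard]
    exact_mod_cast Nat.le_floor hc
  have h2 : ((empiricalCoveringNumber ε F n : ℕ∞) : ℝ≥0∞) ≤ ENNReal.ofReal (Real.exp L) := by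
    refine (ENat.toENNReal_le.2 h1).trans ?_
    rw [ENat.toENNReal_coe, ← ENNReal.ofReal_natCast]
    exact ENNReal.ofReal_le_ofReal (Nat.floor_le (Real.exp_pos L).le)
  refine (ENNReal.log_le_log_iff.2 h2).trans (le_of_eq ?_)
  rw [ENNReal.log_ofReal, if_neg (not_le.2 (Real.exp_pos L)), Real.log_exp]

theorem empiricalL2Dist_lt_iff {X : Type*} {n : ℕ} (x : Fin n → X) (f g : X → ℝ) {a ε : ℝ}
    (ha : a ^ 2 = (n : ℝ)⁻¹) (hε : 0 < ε) :
    empiricalL2Dist x f g < ε ↔ ∑ i, (a * f (x i) - a * g (x i)) ^ 2 < ε ^ 2 := by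
  have : (n : ℝ)⁻¹ * ∑ i, |(f - g) (x i)| ^ 2 = ∑ i, (a * f (x i) - a * g (x i)) ^ 2 := by
    rw [← ha, Finset.mul_sum]
    refine Finset.sum_congr rfl fun i _ => ?_
    rw [sq_abs, Pi.sub_apply]
    ring
  rw [empiricalL2Dist, empiricalL2Norm, this, Real.sqrt_lt' hε]

theorem stateSpace_nonempty {d : ℕ} (hd : 1 ≤ d) : (stateSpace d).Nonempty := by
  refine ⟨Matrix.diagonal (Pi.single ⟨0, hd⟩ 1), ?_, ?_⟩
  · rw [Matrix.posSemidef_diagonal_iff]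
    intro i
    by_cases h : i = ⟨0, hd⟩
    · subst h; simp
    · simp [h]
  · rw [Matrix.trace_diagonal, Finset.sum_pi_single']
    simp

theorem subsingleton_stateSpace_one : (stateSpace 1).Subsingleton := by
  rintro ρ ⟨_, h⟩ σ ⟨_, h'⟩
  rw [Matrix.trace_fin_one] at h h'
  ext i j
  fin_cases i
  fin_cases j
  exact h.trans h'.symm

theorem sum_sq_sub_sampleVectors_le_one {d n : ℕ} {a : ℝ} (han : n * a ^ 2 = 1)
    (x : Fin n → effectSpace d) (ρ σ : stateSpace d) :
    ∑ i, (a * stateFunctional ρ (x i) - a * stateFunctional σ (x i)) ^ 2 ≤ 1 := by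
  have h : ∀ i ∈ Finset.univ,
      (a * stateFunctional ρ (x i) - a * stateFunctional σ (x i)) ^ 2 ≤ a ^ 2 := by
    intro i _
    obtain ⟨h0, h1⟩ := stateFunctional_mem_Icc ρ (x i)
    obtain ⟨h2, h3⟩ := stateFunctional_mem_Icc σ (x i)
    rw [← mul_sub, mul_pow]
    refine mul_le_of_le_one_right (sq_nonneg a) ?_
    rw [sq_le_one_iff_abs_le_one, abs_le]
    constructor <;> linarith
  refine (Finset.sum_le_card_nsmul _ _ _ h).trans (le_of_eq ?_)
  simpa using han

/-- For `d = 1` the target bound is zero, so one center must suffice; there is only one state. For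
`1 < ε` the diameter bound suffices. -/
theorem exists_cover_stateClass_singleton {d n : ℕ} (hd : 1 ≤ d) (hn : 1 ≤ n) {ε : ℝ} (hε : 0 < ε)
    (h : d = 1 ∨ 1 < ε) (x : Fin n → effectSpace d) :
    ∃ g : effectSpace d → ℝ, IsCover (empiricalL2Dist x) ε (stateClass d) {g} := by
  obtain ⟨σ, hσ⟩ := stateSpace_nonempty hd
  refine ⟨stateFunctional ⟨σ, hσ⟩, ?_⟩
  have hn' : (0 : ℝ) < n := by exact_mod_cast hn
  have ha : (Real.sqrt (n : ℝ)⁻¹) ^ 2 = (n : ℝ)⁻¹ := Real.sq_sqrt (by positivity)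
  rintro _ ⟨ρ, rfl⟩
  refine ⟨_, rfl, (empiricalL2Dist_lt_iff x _ _ ha hε).2 ?_⟩
  rcases h with rfl | h
  · have : ρ = ⟨σ, hσ⟩ := Subtype.ext (subsingleton_stateSpace_one ρ.2 hσ)
    rw [this]
    simpa using pow_pos hε 2
  · have := sum_sq_sub_sampleVectors_le_one (by rw [ha]; field_simp) x ρ ⟨σ, hσ⟩
    nlinarith

theorem exists_cover_stateClass {d n p : ℕ} (hd : 1 ≤ d) (hn : 1 ≤ n) (hp : 1 ≤ p)
    (hdp : (d : ℝ) ≤ Real.exp p) {ε : ℝ} (hε : 0 < ε) (k : ℕ) (hk : 2 / 2 ^ k ≤ ε)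
    (x : Fin n → effectSpace d) :
    ∃ G : Finset (effectSpace d → ℝ), IsCover (empiricalL2Dist x) ε (stateClass d) G ∧
      (G.card : ℝ) ≤ Real.exp ((1 + 50 * (110 * p)) * 4 ^ k) := by
  classical
  have hn' : (0 : ℝ) < n := by exact_mod_cast hn
  have hp' : (0 : ℝ) < p := by exact_mod_cast hp
  set a := Real.sqrt (n : ℝ)⁻¹
  have ha : a ^ 2 = (n : ℝ)⁻¹ := Real.sq_sqrt (by positivity)
  have han : n * a ^ 2 = 1 := by rw [ha]; field_simp
  have : Nonempty (stateSpace d) := (stateSpace_nonempty hd).to_subtype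
  obtain ⟨G, hGV, hGc, hG⟩ := exists_cover_of_absPolar (V := sampleVectors a x)
    (K := Real.sqrt (110 * p)) (by positivity) (Set.range_nonempty _)
    (by rintro _ ⟨ρ, rfl⟩ _ ⟨σ, rfl⟩; exact sum_sq_sub_sampleVectors_le_one han x ρ σ)
    (half_le_stdGaussianPi_absPolar_sampleVectors hd hp hdp (Real.sqrt_nonneg _) han x) k
  -- The centers lie in `V`, so each comes from a state and lifts to a function on all effects.
  choose! r hr using hGV
  refine ⟨G.image fun g => stateFunctional (r g), ?_, ?_⟩
  · rintro _ ⟨ρ, rfl⟩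
    obtain ⟨g, hg, hlt⟩ := hG _ ⟨ρ, rfl⟩
    refine ⟨stateFunctional (r g), Finset.mem_coe.2 (Finset.mem_image_of_mem _ hg), ?_⟩
    rw [empiricalL2Dist_lt_iff x _ _ ha hε]
    have h1 := hr g hg
    have h2 : ∀ i, g i = a * stateFunctional (r g) (x i) := fun i => (congrFun h1 i).symm
    simp only [h2] at hlt
    refine hlt.trans_le ?_
    have h3 : (4 : ℝ) / 4 ^ k = (2 / 2 ^ k) ^ 2 := by
      rw [div_pow, ← pow_mul, mul_comm k, pow_mul]
      norm_num
    rw [h3]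
    gcongr
  · rw [Real.sq_sqrt (by positivity)] at hGc
    refine le_trans ?_ hGc
    exact_mod_cast Finset.card_image_le

end QuantumLearning

end

theorem mainTheorem6 :
    ∃ C : ℝ, 0 < C ∧ ∀ (d n : ℕ) (ε : ℝ), 1 ≤ d → 1 ≤ n → 0 < ε →
      QuantumLearning.entropyNumber ε (QuantumLearning.stateClass d) n ≤
        ((C * Real.log (d : ℝ) / ε ^ 2 : ℝ) : EReal) := by
  -- `300000 = 18750 * 16`: the 16 is from `4^(m+1) ≤ 16 / ε^2`, and `1 + 5500 * ⌈log d⌉₊ ≤ 18750 *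
  -- log d` because `1 ≤ 2 * log d` once `d ≥ 2`.
  refine ⟨300000, by norm_num, fun d n ε hd hn hε => QuantumLearning.entropyNumber_le fun x => ?_⟩
  have hd' : (1 : ℝ) ≤ d := by exact_mod_cast hd
  have hlog : 0 ≤ Real.log d := Real.log_nonneg hd'
  by_cases hcase : d = 1 ∨ 1 < ε
  · obtain ⟨g, hg⟩ := QuantumLearning.exists_cover_stateClass_singleton hd hn hε hcase x
    refine ⟨{g}, by simpa using hg, ?_⟩
    rw [Finset.card_singleton, Nat.cast_one]
    exact Real.one_le_exp (by positivity)
  · push Not at hcase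
    have hd2 : (2 : ℝ) ≤ d := by
      have : 2 ≤ d := by omega
      exact_mod_cast this
    have hlog2 : 1 ≤ 2 * Real.log d := by
      linarith [Real.log_two_gt_d9, Real.log_le_log (by norm_num) hd2]
    -- Here `2^m ≤ 2 / ε < 2^(m+1)`: the upper bound makes scale `m + 1` fine enough, the lower one
    -- limits its cost.
    obtain ⟨m, hm1, hm2⟩ := exists_nat_pow_near (x := 2 / ε) (y := (2 : ℝ))
      (by rw [le_div_iff₀ hε]; linarith [hcase.2]) (by norm_num)
    have hp : 1 ≤ ⌈Real.log d⌉₊ := Nat.one_le_ceil_iff.2 (by linarith)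
    have hdp : (d : ℝ) ≤ Real.exp ⌈Real.log d⌉₊ := by
      rw [← Real.log_le_iff_le_exp (by linarith)]
      exact Nat.le_ceil _
    have hk : 2 / 2 ^ (m + 1) ≤ ε := by
      rw [div_lt_iff₀ hε] at hm2
      rw [div_le_iff₀ (by positivity)]
      linarith
    obtain ⟨G, hG, hc⟩ := QuantumLearning.exists_cover_stateClass hd hn hp hdp hε (m + 1) hk x
    refine ⟨G, hG, hc.trans (Real.exp_le_exp.2 ?_)⟩
    have h4 : (4 : ℝ) ^ (m + 1) ≤ 16 / ε ^ 2 := by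
      have h5 : (4 : ℝ) ^ (m + 1) = 4 * (2 ^ m) ^ 2 := by
        rw [← pow_mul, mul_comm m, pow_mul, pow_succ]
        norm_num
        ring
      have h6 : ((2 : ℝ) ^ m) ^ 2 ≤ (2 / ε) ^ 2 := by gcongr
      rw [h5]
      refine (mul_le_mul_of_nonneg_left h6 (by norm_num)).trans (le_of_eq ?_)
      rw [div_pow]
      ring
    have hceil := (Nat.ceil_lt_add_one hlog).le
    calc (1 + 50 * (110 * (⌈Real.log d⌉₊ : ℝ))) * 4 ^ (m + 1)
        ≤ (18750 * Real.log d) * (16 / ε ^ 2) :=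
          mul_le_mul (by linarith) h4 (by positivity) (by positivity)
      _ = 300000 * Real.log d / ε ^ 2 := by ring
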